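/- For each $H\in(0,1)$ let $X^H=(X^H_t)_{t\in[0,1]}$ be a zero-mean Gaussian process with (almost surely) continuous paths, and suppose that there are constants $C_1,C_2>0$, not depending on $H$, such that for all $H\in(0,1)$ \[ C_1|t-s|^H\le \|X^H_t-X^H_s\|_2\le C_2|t-s|^H\qquad\text{for all } t,s\in[0,1], \] where $\|Y\|_2=\sqrt{\mathbf{E}\,Y^2}$. For an integer $n\ge 1$ and a process $X=(X_t)_{t\in[0,1]}$ put \[ \Delta_n(X):=\mathbf{E}\max_{0\le t\le 1}X_t-\mathbf{E}\max_{0\le i\le n}X_{i/n}. \] Let $n(H)\ge 2$, $H\in(0,1)$, be integers such that $\limsup_{H\to0+}\Delta_{n(H)}(X^H)<\infty$. Then $\liminf_{H\to0+}\,(n(H))^H>1$ (the value $+\infty$ being allowed). -/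

import Mathlib

open MeasureTheory ProbabilityTheory Filter Topology

/-- The `L²`-norm `‖Y‖₂ = √(E Y²)` of a real random variable. -/
noncomputable def l2Norm {Ω : Type*} [MeasurableSpace Ω] (P : Measure Ω) (Y : Ω → ℝ) : ℝ :=
  Real.sqrt (∫ ω, (Y ω) ^ 2 ∂P)

/-- The grid point `i / n` of `[0, 1]`, for `0 ≤ i ≤ n`. -/
noncomputable def gridPoint (n : ℕ) (i : Fin (n + 1)) : unitInterval :=
  ⟨(i : ℝ) / (n : ℝ), unitInterval.div_mem (Nat.cast_nonneg _) (Nat.cast_nonneg _)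
    (Nat.cast_le.mpr (Nat.lt_succ_iff.mp i.isLt))⟩

/-- `Δ_n(X) = E max_{0 ≤ t ≤ 1} X_t - E max_{0 ≤ i ≤ n} X_{i/n}`. The suprema are maxima when the
path `t ↦ X_t(ω)` is continuous on `[0, 1]`. -/
noncomputable def discretizationError {Ω : Type*} [MeasurableSpace Ω] (P : Measure Ω)
    (X : unitInterval → Ω → ℝ) (n : ℕ) : ℝ :=
  (∫ ω, (⨆ t : unitInterval, X t ω) ∂P) - ∫ ω, (⨆ i : Fin (n + 1), X (gridPoint n i) ω) ∂P

/-- A zero-mean Gaussian process on `[0, 1]` with almost surely continuous paths. -/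
structure IsCenteredContinuousGaussian {Ω : Type*} [MeasurableSpace Ω] (P : Measure Ω)
    (X : unitInterval → Ω → ℝ) : Prop where
  gaussian : IsGaussianProcess X P
  centered : ∀ t, ∫ ω, X t ω ∂P = 0
  continuous_paths : ∀ᵐ ω ∂P, Continuous fun t => X t ω

/-! At scale `exp (-1/H)` the factor `|t - s| ^ H` is still `1/e`. So about `exp (1/H)` points of
the interval are pairwise `C₁/e`-separated in L², and Sudakov minoration forces the expected maximum
of `X t - X 0` to be at least of order `1/√H`. A grid of `n + 1` points involves increments of
L²-norm at most `C₂`, so its expected maximum is at most of order `√(log n)`. A bounded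
discretization error therefore gives `1/H ≤ A + D * log n` with constants free of `H`; hence `H *
log n` stays away from 0.

Sudakov minoration (`card_le_of_hasGaussianLaw_of_separated`) comes from a change of measure:
translating the vector `Y` along the covariance with `Y i` costs a controlled factor in probability,
and separated variables yield disjoint translated events, whose number is thus bounded. -/

/-! ### Gaussian vectors: translation, expected maxima, Sudakov minoration -/

/-- Exponentially tilting a Gaussian measure by a continuous linear form translates it. -/
theorem isGaussian_tilted_eq_map_add {E : Type*} [NormedAddCommGroup E] [NormedSpace ℝ E]
    [CompleteSpace E] [SecondCountableTopology E] [MeasurableSpace E] [BorelSpace E]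
    (μ : Measure E) [IsGaussian μ] (f : StrongDual ℝ E) (c : E)
    (hc : ∀ L : StrongDual ℝ E, L c = cov[L, f; μ]) :
    μ.tilted f = μ.map (· + c) := by
  have hmem (L : StrongDual ℝ E) : MemLp L 2 μ := IsGaussian.memLp_dual μ L 2 (by norm_num)
  have hmgf (L : StrongDual ℝ E) (t : ℝ) :
      mgf L μ t = Real.exp (μ[L] * t + Var[L; μ] * t ^ 2 / 2) := by
    rw [mgf_gaussianReal (IsGaussian.map_eq_gaussianReal L),
      Real.coe_toNNReal _ (variance_nonneg _ _)]
  have hint : Integrable (fun x => Real.exp (f x)) μ := by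
    have h : 0 < mgf f μ 1 := by rw [hmgf]; positivity
    simpa using mgf_pos_iff.1 h
  have := isProbabilityMeasure_tilted hint
  have : IsProbabilityMeasure (μ.map (· + c)) :=
    Measure.isProbabilityMeasure_map (by fun_prop)
  refine Measure.ext_of_charFunDual (funext fun L => ?_)
  -- Real moment generating functions suffice: by analytic continuation they determine the
  -- characteristic function, read off at `Complex.I`.
  have key : mgf L (μ.tilted f) = mgf id (gaussianReal (μ[L] + L c) Var[L; μ].toNNReal) := by
    ext t
    have h1 : ∫ x, Real.exp ((f + fun x => t * L x) x) ∂μ =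
        mgf (f + t • L : StrongDual ℝ E) μ 1 := by
      simp [mgf]
    have h2 : ∫ x, Real.exp (f x) ∂μ = mgf f μ 1 := by simp [mgf]
    have h3 : Var[(f + t • L : StrongDual ℝ E); μ]
        = Var[f; μ] + 2 * t * L c + t ^ 2 * Var[L; μ] := by
      rw [show ⇑(f + t • L : StrongDual ℝ E) = ⇑f + t • ⇑L from rfl,
        variance_add (hmem f) ((hmem L).const_smul t), variance_smul, covariance_smul_right,
        covariance_comm, hc]
      ring
    have h4 : μ[(f + t • L : StrongDual ℝ E)] = μ[f] + t * μ[L] := by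
      simp only [add_apply, smul_apply, smul_eq_mul]
      rw [integral_add ((hmem f).integrable (by norm_num))
        (((hmem L).integrable (by norm_num)).const_mul t), integral_const_mul]
    rw [mgf, integral_exp_tilted, h1, h2, hmgf, hmgf, h3, h4, mgf_id_gaussianReal, ← Real.exp_sub,
      Real.coe_toNNReal _ (variance_nonneg _ _)]
    congr 1
    ring
  have h := eqOn_complexMGF_of_mgf key.symm (x := Complex.I) (by simp)
  have hmap : (μ.map (· + c)).map L = gaussianReal (μ[L] + L c) Var[L; μ].toNNReal := by
    rw [Measure.map_map (by fun_prop) (by fun_prop), ← gaussianReal_map_add_const,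
      ← IsGaussian.map_eq_gaussianReal L, Measure.map_map (by fun_prop) (by fun_prop)]
    congr 1
    ext x
    simp
  rw [charFunDual_eq_charFun_map_one (μ := μ.map _), hmap, ← complexMGF_id_mul_I]
  simp only [Complex.ofReal_one, one_mul]
  rw [h, charFunDual_apply, complexMGF]
  simp [mul_comm]

/-- The expected maximum of finitely many centered Gaussian variables. -/
theorem integral_iSup_le_of_hasGaussianLaw {Ω ι : Type*} [MeasurableSpace Ω] {P : Measure Ω}
    [Fintype ι] [Nonempty ι] {Y : ι → Ω → ℝ} (hY : ∀ i, HasGaussianLaw (Y i) P)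
    (hmean : ∀ i, ∫ ω, Y i ω ∂P = 0) {v : ℝ} (hv : ∀ i, Var[Y i; P] ≤ v) {β : ℝ} (hβ : 0 < β) :
    Integrable (fun ω => ⨆ i, Y i ω) P ∧
      ∫ ω, (⨆ i, Y i ω) ∂P ≤ Real.log (Fintype.card ι) / β + β * v / 2 := by
  have : IsProbabilityMeasure P := (hY (Classical.arbitrary ι)).isProbabilityMeasure
  have hmgf (i) : mgf (Y i) P β = Real.exp (Var[Y i; P] * β ^ 2 / 2) := by
    rw [mgf_gaussianReal (hY i).map_eq_gaussianReal, Real.coe_toNNReal _ (variance_nonneg _ _),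
      hmean, zero_mul, zero_add]
  have hexp (i) : Integrable (fun ω => Real.exp (β * Y i ω)) P := by
    have h : 0 < mgf (Y i) P β := by rw [hmgf]; positivity
    exact mgf_pos_iff.1 h
  have hmeas : AEMeasurable (fun ω => ⨆ i, Y i ω) P := .iSup fun i => (hY i).aemeasurable
  have hint : Integrable (fun ω => ⨆ i, Y i ω) P := by
    refine Integrable.mono' (g := fun ω => ∑ i, |Y i ω|)
      (integrable_finsetSum _ fun i _ => (hY i).integrable.abs) hmeas.aestronglyMeasurable
      (ae_of_all _ fun ω => ?_)
    have hle (i) : |Y i ω| ≤ ∑ i, |Y i ω| :=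
      Finset.single_le_sum (f := fun i => |Y i ω|) (fun _ _ => abs_nonneg _) (Finset.mem_univ i)
    obtain ⟨i, hi⟩ := exists_eq_ciSup_of_finite (f := fun i => Y i ω)
    rw [← hi]
    exact hle i
  refine ⟨hint, ?_⟩
  -- `exp a` bounds the expected sum of the `exp (β * Y i)`. The tangent inequality `x + 1 ≤ exp x`,
  -- used at `x = β * Y i - a`, plays the role of Jensen's inequality.
  set a : ℝ := Real.log (Fintype.card ι) + v * β ^ 2 / 2 with ha
  have hcard : (0 : ℝ) < Fintype.card ι := by exact_mod_cast Fintype.card_pos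
  have hpt (ω) : β * (⨆ i, Y i ω) ≤ a - 1 + Real.exp (-a) * ∑ i, Real.exp (β * Y i ω) := by
    obtain ⟨i, hi⟩ := exists_eq_ciSup_of_finite (f := fun i => Y i ω)
    rw [← hi]
    have h1 : Real.exp (β * Y i ω) ≤ ∑ i, Real.exp (β * Y i ω) :=
      Finset.single_le_sum (f := fun i => Real.exp (β * Y i ω)) (fun _ _ => by positivity)
        (Finset.mem_univ i)
    have h2 := Real.add_one_le_exp (-a + β * Y i ω)
    rw [Real.exp_add] at h2
    have h3 := mul_le_mul_of_nonneg_left h1 (Real.exp_pos (-a)).le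
    linarith
  have hI : β * ∫ ω, (⨆ i, Y i ω) ∂P ≤ a := by
    have hsum : Integrable (fun ω => ∑ i, Real.exp (β * Y i ω)) P :=
      integrable_finsetSum _ fun i _ => hexp i
    calc β * ∫ ω, (⨆ i, Y i ω) ∂P = ∫ ω, β * (⨆ i, Y i ω) ∂P := (integral_const_mul _ _).symm
      _ ≤ ∫ ω, (a - 1 + Real.exp (-a) * ∑ i, Real.exp (β * Y i ω)) ∂P :=
        integral_mono (hint.const_mul _) ((integrable_const _).add (hsum.const_mul _)) hpt
      _ = a - 1 + Real.exp (-a) * ∑ i, mgf (Y i) P β := by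
        rw [integral_add (integrable_const _) (hsum.const_mul _), integral_const_mul,
          integral_finsetSum _ fun i _ => hexp i]
        simp [mgf]
      _ ≤ a - 1 + Real.exp (-a) * ∑ i : ι, Real.exp (v * β ^ 2 / 2) := by
        gcongr with i
        rw [hmgf]
        gcongr
        exact hv i
      _ = a := by
        rw [Finset.sum_const, Finset.card_univ, nsmul_eq_mul, ← Real.exp_log hcard, ← Real.exp_add,
          ← Real.exp_add, ha]
        simp
  have : ∫ ω, (⨆ i, Y i ω) ∂P ≤ a / β := by rwa [le_div_iff₀' hβ]
  refine this.trans_eq ?_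
  rw [ha]
  field_simp

/-- A lower bound for the probability that a shifted Gaussian vector lies in `S`. -/
theorem exp_mul_measureReal_le_of_hasGaussianLaw {Ω ι : Type*} [MeasurableSpace Ω]
    {P : Measure Ω} [Fintype ι] {Y : ι → Ω → ℝ} (hY : HasGaussianLaw (fun ω i => Y i ω) P)
    (hmean : ∀ i, ∫ ω, Y i ω ∂P = 0) (i : ι) (lam K : ℝ) (hlam : 0 ≤ lam)
    {S : Set (ι → ℝ)} (hS : MeasurableSet S) (hSK : ∀ x ∈ S, x i ≤ K) :
    Real.exp (-(lam * K) - lam ^ 2 * Var[Y i; P] / 2) * P.real {ω | (fun j => Y j ω) ∈ S} ≤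
      P.real {ω | (fun j => Y j ω - lam * cov[Y j, Y i; P]) ∈ S} := by
  have : IsProbabilityMeasure P := hY.isProbabilityMeasure
  classical
  set μ : Measure (ι → ℝ) := P.map (fun ω i => Y i ω) with hμ
  have : IsGaussian μ := hY.isGaussian_map
  have hYm : AEMeasurable (fun ω i => Y i ω) P := hY.aemeasurable
  let f : StrongDual ℝ (ι → ℝ) := (-lam) • ContinuousLinearMap.proj i
  let c : ι → ℝ := fun j => -lam * cov[Y j, Y i; P]
  have hmem (j) : MemLp (Y j) 2 P := (hY.eval j).memLp_two
  have hcov (L : StrongDual ℝ (ι → ℝ)) : L c = cov[L, f; μ] := by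
    have hL (x : ι → ℝ) : L x = ∑ j, x j * L (Pi.single j 1) := by
      conv_lhs => rw [pi_eq_sum_univ' x]
      simp [map_sum, map_smul]
    have h1 : cov[L, f; μ] =
        cov[fun ω => ∑ j, Y j ω * L (Pi.single j 1), fun ω => -lam * Y i ω; P] := by
      rw [hμ, covariance_map (by fun_prop) (by fun_prop) hYm]
      congr 1
      ext ω
      simp [hL (fun j => Y j ω)]
    rw [h1, covariance_fun_sum_left (fun j => (hmem j).mul_const _) ((hmem i).const_mul _), hL c]
    refine Finset.sum_congr rfl fun j _ => ?_
    rw [covariance_const_mul_right, covariance_mul_const_left]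
    simp only [c]
    ring
  have htilt := isGaussian_tilted_eq_map_add μ f c hcov
  have hmapS : P.real {ω | (fun j => Y j ω - lam * cov[Y j, Y i; P]) ∈ S} =
      (μ.map (· + c)).real S := by
    rw [map_measureReal_apply (by fun_prop) hS, hμ,
      map_measureReal_apply_of_aemeasurable hYm (measurable_add_const c hS)]
    congr 1
    ext ω
    simp only [Set.mem_ofPred_eq, Set.mem_preimage]
    congr! 1
    ext j
    simp [c]
    ring
  have hμS : P.real {ω | (fun j => Y j ω) ∈ S} = μ.real S := by
    rw [hμ, map_measureReal_apply_of_aemeasurable hYm hS]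
    rfl
  have hZ : ∫ x, Real.exp (f x) ∂μ = Real.exp (lam ^ 2 * Var[Y i; P] / 2) := by
    have h : ∫ x, Real.exp (f x) ∂μ = mgf (Y i) P (-lam) := by
      rw [hμ, integral_map hYm (by fun_prop)]
      simp [mgf, f]
    rw [h, mgf_gaussianReal (hY.eval i).map_eq_gaussianReal,
      Real.coe_toNNReal _ (variance_nonneg _ _), hmean]
    congr 1
    ring
  rw [hmapS, hμS, ← htilt, measureReal_def (μ.tilted f), tilted_apply' μ f hS, hZ]
  -- On `S` the tilting density is bounded below, because there `x i ≤ K`.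
  have hlow : ∫⁻ _ in S, ENNReal.ofReal (Real.exp (-(lam * K) - lam ^ 2 * Var[Y i; P] / 2)) ∂μ ≤
      ∫⁻ x in S, ENNReal.ofReal (Real.exp (f x) / Real.exp (lam ^ 2 * Var[Y i; P] / 2)) ∂μ := by
    refine setLIntegral_mono' hS fun x hx => ENNReal.ofReal_le_ofReal ?_
    rw [← Real.exp_sub]
    have h := mul_le_mul_of_nonneg_left (hSK x hx) hlam
    gcongr
    simpa [f] using h
  have hfin : ∫⁻ x in S, ENNReal.ofReal (Real.exp (f x) / Real.exp (lam ^ 2 * Var[Y i; P] / 2)) ∂μ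
      ≠ ⊤ := by
    rw [← hZ, ← tilted_apply' μ f hS, htilt]
    exact measure_ne_top _ _
  have h := ENNReal.toReal_mono hfin hlow
  rwa [setLIntegral_const, ENNReal.toReal_mul, ENNReal.toReal_ofReal (Real.exp_pos _).le] at h

/-- **Sudakov minoration** for separated Gaussian vectors of bounded diameter. -/
theorem card_le_of_hasGaussianLaw_of_separated {Ω ι : Type*} [MeasurableSpace Ω]
    {P : Measure Ω} [Fintype ι] {Y : ι → Ω → ℝ} (hY : HasGaussianLaw (fun ω i => Y i ω) P)
    (hmean : ∀ i, ∫ ω, Y i ω ∂P = 0) {M : ℝ} (hM : 0 < M) (hnonneg : ∀ ω, 0 ≤ ⨆ i, Y i ω)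
    (hint : Integrable (fun ω => ⨆ i, Y i ω) P) (hle : ∫ ω, (⨆ i, Y i ω) ∂P ≤ M)
    {a v lam : ℝ} (hsep : ∀ i j, i ≠ j → a ≤ Var[fun ω => Y i ω - Y j ω; P])
    (hv : ∀ i, Var[Y i; P] ≤ v) (hlam : 0 ≤ lam) (hlam' : 16 * M < lam * a) :
    (Fintype.card ι : ℝ) ≤ 2 * Real.exp (4 * M * lam + lam ^ 2 * v / 2) := by
  have : IsProbabilityMeasure P := hY.isProbabilityMeasure
  have hm (i) : AEMeasurable (Y i) P := (hY.eval i).aemeasurable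
  have hmem (j) : MemLp (Y j) 2 P := (hY.eval j).memLp_two
  have hupper : P.real {ω | 4 * M ≤ ⨆ i, Y i ω} ≤ 1 / 4 := by
    have h := mul_meas_ge_le_integral_of_nonneg (ae_of_all _ hnonneg) hint (4 * M)
    nlinarith
  have hlower (i) : P.real {ω | Y i ω ≤ -(4 * M)} ≤ 1 / 4 := by
    have hlaw : P.map (Y i) = P.map (fun ω => -Y i ω) := by
      have h := AEMeasurable.map_map_of_aemeasurable (g := fun x : ℝ => -x) (by fun_prop) (hm i)
      rw [(hY.eval i).map_eq_gaussianReal, gaussianReal_map_neg, hmean, neg_zero] at h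
      rw [(hY.eval i).map_eq_gaussianReal, hmean, h]
      rfl
    have h1 : P.real {ω | Y i ω ≤ -(4 * M)} = P.real {ω | 4 * M ≤ Y i ω} := by
      have h2 := congrArg (fun μ : Measure ℝ => μ.real (Set.Ici (4 * M))) hlaw
      rw [map_measureReal_apply_of_aemeasurable (hm i) measurableSet_Ici,
        map_measureReal_apply_of_aemeasurable (hm i).fun_neg measurableSet_Ici] at h2
      convert! h2.symm using 2
      ext ω
      simp [le_neg]
    rw [h1]
    refine (measureReal_mono fun ω hω => ?_).trans hupper
    exact le_trans hω (le_ciSup (Set.finite_range fun i => Y i ω).bddAbove i)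
  -- By Markov's inequality and symmetry, each of the two constraints fails with probability at most
  -- 1/4.
  let S (i : ι) : Set (ι → ℝ) := {x | (∀ j, x j ≤ 4 * M) ∧ -(4 * M) ≤ x i}
  have hS (i) : MeasurableSet (S i) := by
    refine MeasurableSet.inter ?_ ?_
    · exact MeasurableSet.univ_pi' fun j => measurableSet_Iic
    · exact measurableSet_le measurable_const (measurable_pi_apply i)
  have hPS (i) : 1 / 2 ≤ P.real {ω | (fun j => Y j ω) ∈ S i} := by
    have hcover : (Set.univ : Set Ω) ⊆ {ω | (fun j => Y j ω) ∈ S i} ∪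
        ({ω | 4 * M ≤ ⨆ i, Y i ω} ∪ {ω | Y i ω ≤ -(4 * M)}) := by
      intro ω _
      by_contra! hω
      simp only [Set.mem_union, Set.mem_ofPred_eq, not_or, not_le] at hω
      refine hω.1 ⟨fun j => ?_, hω.2.2.le⟩
      exact (le_ciSup (Set.finite_range fun i => Y i ω).bddAbove j).trans hω.2.1.le
    have h1 := measureReal_mono (μ := P) hcover
    have h2 := measureReal_union_le (μ := P) {ω | (fun j => Y j ω) ∈ S i}
      ({ω | 4 * M ≤ ⨆ i, Y i ω} ∪ {ω | Y i ω ≤ -(4 * M)})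
    have h3 := measureReal_union_le (μ := P) {ω | 4 * M ≤ ⨆ i, Y i ω} {ω | Y i ω ≤ -(4 * M)}
    have h4 := hlower i
    rw [probReal_univ] at h1
    linarith
  let E (i : ι) : Set Ω := {ω | (fun j => Y j ω - lam * cov[Y j, Y i; P]) ∈ S i}
  have hE (i) : NullMeasurableSet (E i) P := by
    have : AEMeasurable (fun ω j => Y j ω - lam * cov[Y j, Y i; P]) P :=
      aemeasurable_pi_lambda _ fun j => (hm j).sub_const _
    exact this.nullMeasurableSet_preimage (hS i)
  -- On a common point of `E i` and `E j`, adding the four inequalities gives `lam * Var(Y i - Y j)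
  -- ≤ 16 * M`, against `hlam'`.
  have hdisj : Pairwise fun i j => Disjoint (E i) (E j) := by
    intro i j hij
    rw [Set.disjoint_left]
    rintro ω ⟨h1, h2⟩ ⟨h3, h4⟩
    have h5 := hsep i j hij
    rw [variance_fun_sub (hmem i) (hmem j), ← covariance_self (hm i), ← covariance_self (hm j)] at h5
    have h6 := mul_le_mul_of_nonneg_left h5 hlam
    have h7 := h1 j
    have h8 := h3 i
    simp only [covariance_comm (Y j) (Y i)] at h2 h4 h7 h8
    linarith
  have hPE (i) : Real.exp (-(4 * M * lam + lam ^ 2 * v / 2)) * (1 / 2) ≤ P.real (E i) := by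
    refine le_trans ?_ (exp_mul_measureReal_le_of_hasGaussianLaw hY hmean i lam (4 * M) hlam (hS i)
      fun x hx => hx.1 i)
    have h := mul_le_mul_of_nonneg_left (hv i) (sq_nonneg lam)
    gcongr
    · linarith
    · exact hPS i
  have hsum : ∑ i, P.real (E i) ≤ 1 := by
    rw [← measureReal_biUnion_finset₀ (fun i _ j _ hij => (hdisj hij).aedisjoint) fun i _ => hE i]
    exact measureReal_le_one
  have h1 : (Fintype.card ι : ℝ) * (Real.exp (-(4 * M * lam + lam ^ 2 * v / 2)) * (1 / 2)) ≤ 1 := by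
    refine le_trans ?_ hsum
    rw [← nsmul_eq_mul, ← Finset.card_univ]
    exact Finset.card_nsmul_le_sum _ _ _ fun i _ => hPE i
  rw [Real.exp_neg] at h1
  have h2 := Real.exp_pos (4 * M * lam + lam ^ 2 * v / 2)
  rwa [inv_mul_eq_div, mul_div_assoc', div_le_one h2, mul_one_div, div_le_iff₀' two_pos] at h1

/-! ### Grid maxima, dyadic chaining and integrability of the maximum -/

theorem gridPoint_zero (n : ℕ) : gridPoint n 0 = 0 := by
  ext
  simp [gridPoint]

/-- Grid maxima of a continuous function converge to its maximum. -/
theorem tendsto_iSup_gridPoint {f : unitInterval → ℝ} (hf : Continuous f) :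
    Tendsto (fun n : ℕ => ⨆ i, f (gridPoint n i)) atTop (𝓝 (⨆ t, f t)) := by
  have hbdd : BddAbove (Set.range f) := (isCompact_range hf).bddAbove
  obtain ⟨t, -, ht⟩ := isCompact_univ.exists_isMaxOn Set.univ_nonempty hf.continuousOn
  have hsup : ⨆ s, f s = f t :=
    le_antisymm (ciSup_le fun s => ht (Set.mem_univ s)) (le_ciSup hbdd t)
  -- The last grid point not exceeding the maximizer `t`.
  let i (n : ℕ) : Fin (n + 1) := ⟨⌊(t : ℝ) * n⌋₊, by
    have h : ⌊(t : ℝ) * n⌋₊ ≤ n :=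
      Nat.floor_le_of_le (mul_le_of_le_one_left (Nat.cast_nonneg n) t.2.2)
    omega⟩
  have hi : Tendsto (fun n => gridPoint n (i n)) atTop (𝓝 t) := by
    rw [tendsto_subtype_rng]
    exact (tendsto_nat_floor_mul_div_atTop t.2.1).comp tendsto_natCast_atTop_atTop
  rw [hsup]
  refine tendsto_of_tendsto_of_tendsto_of_le_of_le ((hf.tendsto t).comp hi) tendsto_const_nhds
    (fun n => ?_) fun n => ?_
  · exact le_ciSup (f := fun j => f (gridPoint n j)) (Set.finite_range _).bddAbove (i n)
  · exact ciSup_le fun j => ht (Set.mem_univ _)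

section

variable {Ω : Type*} [MeasurableSpace Ω] {P : Measure Ω} {X : unitInterval → Ω → ℝ}

theorem IsCenteredContinuousGaussian.isProbabilityMeasure (hX : IsCenteredContinuousGaussian P X) :
    IsProbabilityMeasure P :=
  hX.gaussian.isProbabilityMeasure

theorem IsCenteredContinuousGaussian.integral_sub (hX : IsCenteredContinuousGaussian P X)
    (t s : unitInterval) : ∫ ω, (X t ω - X s ω) ∂P = 0 := by
  rw [MeasureTheory.integral_sub (hX.gaussian.hasGaussianLaw_eval t).integrable
    (hX.gaussian.hasGaussianLaw_eval s).integrable, hX.centered, hX.centered, sub_zero]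

theorem IsCenteredContinuousGaussian.variance_sub (hX : IsCenteredContinuousGaussian P X)
    (t s : unitInterval) :
    Var[fun ω => X t ω - X s ω; P] = l2Norm P (fun ω => X t ω - X s ω) ^ 2 := by
  rw [l2Norm, Real.sq_sqrt (integral_nonneg fun _ => sq_nonneg _),
    variance_of_integral_eq_zero (hX.gaussian.hasGaussianLaw_fun_sub).aemeasurable
      (hX.integral_sub t s)]

/-- The expected maximum of finitely many increments of lengths at most `d`. -/
theorem IsCenteredContinuousGaussian.integral_iSup_sub_le (hX : IsCenteredContinuousGaussian P X)
    {ι : Type*} [Fintype ι] [Nonempty ι] (p q : ι → unitInterval) {σ : ℝ}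
    (hσ : ∀ i, l2Norm P (fun ω => X (p i) ω - X (q i) ω) ≤ σ) {β : ℝ} (hβ : 0 < β) :
    Integrable (fun ω => ⨆ i, (X (p i) ω - X (q i) ω)) P ∧
      ∫ ω, (⨆ i, (X (p i) ω - X (q i) ω)) ∂P ≤
        Real.log (Fintype.card ι) / β + β * σ ^ 2 / 2 := by
  refine integral_iSup_le_of_hasGaussianLaw (fun i => hX.gaussian.hasGaussianLaw_fun_sub)
    (fun i => hX.integral_sub _ _) (fun i => ?_) hβ
  rw [hX.variance_sub]
  exact pow_le_pow_left₀ (Real.sqrt_nonneg _) (hσ i) 2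

theorem l2Norm_sub_le_of_forall_le_rpow {H C : ℝ} (hH : 0 < H) (hC : 0 ≤ C)
    (hinc : ∀ t s : unitInterval,
      l2Norm P (fun ω => X t ω - X s ω) ≤ C * |(t : ℝ) - (s : ℝ)| ^ H) (t s : unitInterval) :
    l2Norm P (fun ω => X t ω - X s ω) ≤ C := by
  refine (hinc t s).trans (mul_le_of_le_one_right hC (Real.rpow_le_one (abs_nonneg _) ?_ hH.le))
  rw [abs_le]
  constructor <;> linarith [t.2.1, t.2.2, s.2.1, s.2.2]

/-- Dyadic chaining step. -/
theorem IsCenteredContinuousGaussian.integral_iSup_gridPoint_two_pow_succ_le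
    (hX : IsCenteredContinuousGaussian P X) {H C : ℝ} (hH : 0 < H) (hC : 0 < C)
    (hinc : ∀ t s : unitInterval,
      l2Norm P (fun ω => X t ω - X s ω) ≤ C * |(t : ℝ) - (s : ℝ)| ^ H) (k : ℕ) :
    ∫ ω, (⨆ i, (X (gridPoint (2 ^ (k + 1)) i) ω - X 0 ω)) ∂P ≤
      ∫ ω, (⨆ i, (X (gridPoint (2 ^ k) i) ω - X 0 ω)) ∂P +
        C * (((1 / 2 : ℝ) ^ H) ^ (k + 1) * (k + 3)) := by
  have := hX.isProbabilityMeasure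
  let par (i : Fin (2 ^ (k + 1) + 1)) : Fin (2 ^ k + 1) := ⟨i / 2, by
    have h := i.isLt
    have h2 := pow_succ 2 k
    omega⟩
  set σ : ℝ := C * ((1 / 2 : ℝ) ^ H) ^ (k + 1) with hσ
  have hσ0 : 0 < σ := by positivity
  have hdist (i) : |(gridPoint (2 ^ (k + 1)) i : ℝ) - gridPoint (2 ^ k) (par i)|
      ≤ (1 / 2) ^ (k + 1) := by
    have h1 : (gridPoint (2 ^ (k + 1)) i : ℝ) - gridPoint (2 ^ k) (par i)
        = ((i : ℕ) - 2 * ((i / 2 : ℕ) : ℝ)) * (1 / 2) ^ (k + 1) := by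
      simp only [gridPoint, par]
      push_cast
      have h := pow_succ (2 : ℝ) k
      rw [div_pow, one_pow, h]
      field_simp
    have h2 : ((i : ℕ) : ℝ) = 2 * ((i / 2 : ℕ) : ℝ) + ((i % 2 : ℕ) : ℝ) := by
      exact_mod_cast (Nat.div_add_mod (i : ℕ) 2).symm
    have h3 : ((i % 2 : ℕ) : ℝ) ≤ 1 := by
      exact_mod_cast Nat.le_of_lt_succ (Nat.mod_lt _ two_pos)
    rw [h1, h2, add_sub_cancel_left, abs_of_nonneg (by positivity)]
    exact mul_le_of_le_one_left (by positivity) h3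
  -- The choice `β = σ⁻¹` loses a square root of the logarithm, which is harmless: `σ` decays
  -- geometrically in `k`.
  have hstep := hX.integral_iSup_sub_le (gridPoint (2 ^ (k + 1)))
    (fun i => gridPoint (2 ^ k) (par i)) (σ := σ) (fun i => by
      refine (hinc _ _).trans ?_
      rw [hσ, ← Real.rpow_natCast, ← Real.rpow_mul (by norm_num), mul_comm H,
        Real.rpow_mul (by norm_num), Real.rpow_natCast]
      gcongr
      exact hdist i) (β := σ⁻¹) (by positivity)
  have hint (n : ℕ) := (hX.integral_iSup_sub_le (gridPoint n) (fun _ => 0) (σ := C)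
      (fun _ => l2Norm_sub_le_of_forall_le_rpow hH hC.le hinc _ _) one_pos).1
  have hlog : Real.log (Fintype.card (Fin (2 ^ (k + 1) + 1))) ≤ k + 2 := by
    rw [Fintype.card_fin]
    calc Real.log ((2 ^ (k + 1) + 1 : ℕ) : ℝ) ≤ Real.log (2 ^ (k + 2)) := by
          refine Real.log_le_log (by positivity) ?_
          have := one_le_pow₀ (M₀ := ℝ) one_le_two (n := k + 1)
          push_cast
          rw [pow_succ _ (k + 1)]
          linarith
      _ = (k + 2) * Real.log 2 := by rw [Real.log_pow]; push_cast; ring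
      _ ≤ k + 2 := mul_le_of_le_one_right (by positivity) (by linarith [Real.log_two_lt_d9])
  calc ∫ ω, (⨆ i, (X (gridPoint (2 ^ (k + 1)) i) ω - X 0 ω)) ∂P
      ≤ ∫ ω, ((⨆ i, (X (gridPoint (2 ^ k) i) ω - X 0 ω)) +
          ⨆ i, (X (gridPoint (2 ^ (k + 1)) i) ω - X (gridPoint (2 ^ k) (par i)) ω)) ∂P := by
        refine integral_mono (hint _) ((hint _).add hstep.1) fun ω => ciSup_le fun i => ?_
        have h1 := le_ciSup (f := fun i => X (gridPoint (2 ^ k) i) ω - X 0 ω)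
          (Set.finite_range _).bddAbove (par i)
        have h2 := le_ciSup
          (f := fun i => X (gridPoint (2 ^ (k + 1)) i) ω - X (gridPoint (2 ^ k) (par i)) ω)
          (Set.finite_range _).bddAbove i
        linarith
    _ ≤ _ := by
        rw [integral_add (hint _) hstep.1]
        gcongr
        refine hstep.2.trans ?_
        rw [← mul_assoc, ← hσ, div_inv_eq_mul]
        have h1 := mul_le_mul_of_nonneg_right hlog hσ0.le
        have h2 : σ⁻¹ * σ ^ 2 / 2 = σ / 2 := by field_simp
        rw [h2]
        linarith

/-- Chaining bounds the expected dyadic maxima by a convergent series, and Fatou's lemma passes to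
the limit. Integrability is essential since a Bochner integral defaults to 0; the bound need not be
uniform in `H`. -/
theorem IsCenteredContinuousGaussian.integrable_iSup
    (hX : IsCenteredContinuousGaussian P X) {H C : ℝ} (hH : 0 < H) (hC : 0 < C)
    (hinc : ∀ t s : unitInterval,
      l2Norm P (fun ω => X t ω - X s ω) ≤ C * |(t : ℝ) - (s : ℝ)| ^ H) :
    Integrable (fun ω => ⨆ t, (X t ω - X 0 ω)) P := by
  have := hX.isProbabilityMeasure
  set r : ℝ := (1 / 2 : ℝ) ^ H
  have hr0 : 0 < r := by positivity
  have hr1 : r < 1 := Real.rpow_lt_one (by norm_num) (by norm_num) hH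
  set u : ℕ → ℝ := fun k => C * (r ^ (k + 1) * (k + 3)) with hu
  have hu0 (k) : 0 ≤ u k := by positivity
  have hus : Summable u := by
    have h1 : Summable fun k : ℕ => (k : ℝ) ^ 1 * r ^ k :=
      summable_pow_mul_geometric_of_norm_lt_one 1 (by rwa [Real.norm_of_nonneg hr0.le])
    have h2 : Summable fun k : ℕ => r ^ k := summable_geometric_of_lt_one hr0.le hr1
    refine ((h1.add (h2.mul_left 3)).mul_left (C * r)).congr fun k => ?_
    simp only [hu]
    ring
  let M (k : ℕ) (ω : Ω) : ℝ := ⨆ i, (X (gridPoint (2 ^ k) i) ω - X 0 ω)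
  have hM0 (k ω) : 0 ≤ M k ω := by
    have h := le_ciSup (f := fun i => X (gridPoint (2 ^ k) i) ω - X 0 ω)
      (Set.finite_range _).bddAbove 0
    simpa [gridPoint_zero] using h
  have hbound (k) : ∫ ω, M k ω ∂P ≤ ∫ ω, M 0 ω ∂P + ∑' j, u j := by
    have h : ∫ ω, M k ω ∂P ≤ ∫ ω, M 0 ω ∂P + ∑ j ∈ Finset.range k, u j := by
      induction k with
      | zero => simp
      | succ k ih =>
        have h := hX.integral_iSup_gridPoint_two_pow_succ_le hH hC hinc k
        rw [Finset.sum_range_succ]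
        change ∫ ω, M (k + 1) ω ∂P ≤ ∫ ω, M k ω ∂P + u k at h
        linarith
    exact h.trans (by gcongr; exact hus.sum_le_tsum _ fun j _ => hu0 j)
  have hint (k) : Integrable (M k) P :=
    (hX.integral_iSup_sub_le (gridPoint (2 ^ k)) (fun _ => 0) (σ := C)
      (fun _ => l2Norm_sub_le_of_forall_le_rpow hH hC.le hinc _ _)
      one_pos).1
  have hlim : ∀ᵐ ω ∂P, Tendsto (fun k => M k ω) atTop (𝓝 (⨆ t, (X t ω - X 0 ω))) := by
    filter_upwards [hX.continuous_paths] with ω hω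
    exact (tendsto_iSup_gridPoint (hω.sub continuous_const)).comp
      (tendsto_pow_atTop_atTop_of_one_lt one_lt_two)
  have hmeas : AEStronglyMeasurable (fun ω => ⨆ t, (X t ω - X 0 ω)) P :=
    aestronglyMeasurable_of_tendsto_ae atTop (fun k => (hint k).1) hlim
  refine ⟨hmeas, ?_⟩
  rw [hasFiniteIntegral_iff_norm]
  have hlim' : ∀ᵐ ω ∂P, Tendsto (fun k => ENNReal.ofReal (M k ω)) atTop
      (𝓝 (ENNReal.ofReal ‖⨆ t, (X t ω - X 0 ω)‖)) := by
    filter_upwards [hlim] with ω hω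
    rw [Real.norm_of_nonneg (ge_of_tendsto' hω fun k => hM0 k ω)]
    exact ENNReal.tendsto_ofReal hω
  calc ∫⁻ ω, ENNReal.ofReal ‖⨆ t, (X t ω - X 0 ω)‖ ∂P
      = ∫⁻ ω, liminf (fun k => ENNReal.ofReal (M k ω)) atTop ∂P :=
        lintegral_congr_ae (hlim'.mono fun ω hω => hω.liminf_eq.symm)
    _ ≤ liminf (fun k => ∫⁻ ω, ENNReal.ofReal (M k ω) ∂P) atTop :=
        lintegral_liminf_le' fun k => (hint k).1.aemeasurable.ennreal_ofReal
    _ ≤ ENNReal.ofReal (∫ ω, M 0 ω ∂P + ∑' j, u j) := by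
        refine liminf_le_of_le (by isBoundedDefault) fun b hb => ?_
        obtain ⟨k, hk⟩ := hb.exists
        refine hk.trans ?_
        rw [← ofReal_integral_eq_lintegral_ofReal (hint k) (ae_of_all _ (hM0 k))]
        exact ENNReal.ofReal_le_ofReal (hbound k)
    _ < ⊤ := ENNReal.ofReal_lt_top

theorem IsCenteredContinuousGaussian.hasGaussianLaw_sub_zero
    (hX : IsCenteredContinuousGaussian P X) {ι : Type*} [Fintype ι] (p : ι → unitInterval) :
    HasGaussianLaw (fun ω i => X (p i) ω - X 0 ω) P := by
  classical
  let I : Finset unitInterval := insert 0 (Finset.univ.image p)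
  let L : (I → ℝ) →L[ℝ] (ι → ℝ) := ContinuousLinearMap.pi fun i =>
    ContinuousLinearMap.proj (R := ℝ) (φ := fun _ : I => ℝ) ⟨p i, by simp [I]⟩ -
      ContinuousLinearMap.proj (R := ℝ) (φ := fun _ : I => ℝ) ⟨0, by simp [I]⟩
  have h := (hX.gaussian.hasGaussianLaw I).map_fun L
  convert! h

/-- Only increments are controlled, and subtracting the centered variable `X 0` from both maxima
changes neither expectation. -/
theorem discretizationError_eq_integral_sub_zero (hX : IsCenteredContinuousGaussian P X) {n : ℕ}
    (hsup : Integrable (fun ω => ⨆ t, (X t ω - X 0 ω)) P)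
    (hgrid : Integrable (fun ω => ⨆ i, (X (gridPoint n i) ω - X 0 ω)) P) :
    discretizationError P X n =
      ∫ ω, (⨆ t, (X t ω - X 0 ω)) ∂P - ∫ ω, (⨆ i, (X (gridPoint n i) ω - X 0 ω)) ∂P := by
  have h0 : Integrable (X 0) P := (hX.gaussian.hasGaussianLaw_eval 0).integrable
  have h1 : ∫ ω, (⨆ t : unitInterval, X t ω) ∂P = ∫ ω, (⨆ t, (X t ω - X 0 ω)) ∂P := by
    have h : ∫ ω, (⨆ t : unitInterval, X t ω) ∂P =
        ∫ ω, ((⨆ t, (X t ω - X 0 ω)) + X 0 ω) ∂P := by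
      refine integral_congr_ae ?_
      filter_upwards [hX.continuous_paths] with ω hω
      rw [← ciSup_sub (isCompact_range hω).bddAbove, sub_add_cancel]
    rw [h, integral_add hsup h0, hX.centered, add_zero]
  have h2 : ∫ ω, (⨆ i, X (gridPoint n i) ω) ∂P =
      ∫ ω, (⨆ i, (X (gridPoint n i) ω - X 0 ω)) ∂P := by
    have h : ∫ ω, (⨆ i, X (gridPoint n i) ω) ∂P =
        ∫ ω, ((⨆ i, (X (gridPoint n i) ω - X 0 ω)) + X 0 ω) ∂P := by
      refine integral_congr_ae (ae_of_all _ fun ω => ?_)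
      simp only
      rw [← ciSup_sub (Set.finite_range fun i => X (gridPoint n i) ω).bddAbove, sub_add_cancel]
    rw [h, integral_add hgrid h0, hX.centered, add_zero]
  rw [discretizationError, h1, h2]

/-! ### Upper bounds on `1/H` and the conclusion -/

theorem one_div_le_abs_gridPoint_sub {n : ℕ} (hn : 0 < n) {i j : Fin (n + 1)} (hij : i ≠ j) :
    1 / (n : ℝ) ≤ |(gridPoint n i : ℝ) - gridPoint n j| := by
  have hn' : (0 : ℝ) < n := by exact_mod_cast hn
  have h : (1 : ℝ) ≤ |((i : ℕ) : ℝ) - ((j : ℕ) : ℝ)| := by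
    have h1 : (1 : ℤ) ≤ |((i : ℕ) : ℤ) - ((j : ℕ) : ℤ)| :=
      Int.one_le_abs (sub_ne_zero.2 fun h => hij (Fin.ext (by exact_mod_cast h)))
    exact_mod_cast h1
  simp only [gridPoint]
  rw [← sub_div, abs_div, abs_of_pos hn']
  gcongr

/-- A lower bound for the expected maximum of a process with small exponent `H`. -/
theorem IsCenteredContinuousGaussian.one_div_le_of_integral_iSup_le
    (hX : IsCenteredContinuousGaussian P X) {H C₁ C₂ : ℝ} (hH : 0 < H)
    (hC₁ : 0 < C₁) (hC₂ : 0 < C₂)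
    (hinc : ∀ t s : unitInterval,
      C₁ * |(t : ℝ) - (s : ℝ)| ^ H ≤ l2Norm P (fun ω => X t ω - X s ω) ∧
      l2Norm P (fun ω => X t ω - X s ω) ≤ C₂ * |(t : ℝ) - (s : ℝ)| ^ H)
    {M a : ℝ} (hM : 0 < M) (hle : ∫ ω, (⨆ t, (X t ω - X 0 ω)) ∂P ≤ M)
    (ha : a = (C₁ * Real.exp (-1)) ^ 2) :
    1 / H ≤ Real.log 2 + (68 / a + 289 * C₂ ^ 2 / (2 * a ^ 2)) * M ^ 2 := by
  have hbd := l2Norm_sub_le_of_forall_le_rpow hH hC₂.le fun t s => (hinc t s).2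
  have ha0 : 0 < a := by rw [ha]; positivity
  -- Rounding down keeps `(1/N) ^ H ≥ exp (-1)`, while the grid still has `N + 1 > exp (1/H)`
  -- points.
  set N : ℕ := ⌊Real.exp (1 / H)⌋₊ with hN
  have hN0 : 0 < N := Nat.floor_pos.2 (Real.one_le_exp (by positivity))
  have hN' : (0 : ℝ) < N := by exact_mod_cast hN0
  have hNle : (N : ℝ) ≤ Real.exp (1 / H) := Nat.floor_le (Real.exp_pos _).le
  have hNlt : Real.exp (1 / H) < N + 1 := Nat.lt_floor_add_one _
  have hint := (hX.integral_iSup_sub_le (gridPoint N) (fun _ => 0) (fun _ => hbd _ _) one_pos).1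
  have hsup := hX.integrable_iSup hH hC₂ fun t s => (hinc t s).2
  have hmono : ∫ ω, (⨆ i, (X (gridPoint N i) ω - X 0 ω)) ∂P ≤ M := by
    refine le_trans (integral_mono_ae hint hsup ?_) hle
    filter_upwards [hX.continuous_paths] with ω hω
    exact ciSup_le fun i => le_ciSup (f := fun t => X t ω - X 0 ω)
      (isCompact_range (hω.sub continuous_const)).bddAbove _
  -- The factor 17 just clears `16 * M < lam * a`; it produces `68 = 4 * 17` and `289 = 17 ^ 2`.
  have hcard := card_le_of_hasGaussianLaw_of_separated (a := a) (v := C₂ ^ 2) (lam := 17 * M / a)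
    (hX.hasGaussianLaw_sub_zero (gridPoint N)) (fun i => hX.integral_sub _ _) hM
    (fun ω => by
      simpa [gridPoint_zero] using le_ciSup (f := fun i => X (gridPoint N i) ω - X 0 ω)
        (Set.finite_range _).bddAbove 0) hint hmono
    (fun i j hij => by
      simp only [sub_sub_sub_cancel_right]
      rw [hX.variance_sub, ha]
      refine pow_le_pow_left₀ (by positivity) (le_trans ?_ (hinc _ _).1) 2
      gcongr
      calc Real.exp (-1) = (1 / Real.exp (1 / H)) ^ H := by
            rw [one_div, ← Real.exp_neg, ← Real.exp_mul]
            congr 1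
            field_simp
        _ ≤ (1 / (N : ℝ)) ^ H := by gcongr
        _ ≤ _ := by
            gcongr
            exact one_div_le_abs_gridPoint_sub hN0 hij)
    (fun i => by
      rw [hX.variance_sub]
      exact pow_le_pow_left₀ (Real.sqrt_nonneg _) (hbd _ _) 2)
    (by positivity) (by rw [div_mul_cancel₀ _ ha0.ne']; linarith)
  rw [Fintype.card_fin, Nat.cast_add, Nat.cast_one] at hcard
  have h := Real.log_le_log (Real.exp_pos _) (hNlt.le.trans hcard)
  rw [Real.log_exp, Real.log_mul (by norm_num) (Real.exp_pos _).ne', Real.log_exp] at h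
  refine h.trans_eq ?_
  field_simp
  ring

/-- The full expected maximum is the error plus the grid's, hence at most `B + O(√(log n))`; the
Sudakov bound is quadratic in it, so it is linear in `log n`. -/
theorem IsCenteredContinuousGaussian.one_div_le_of_discretizationError_le
    (hX : IsCenteredContinuousGaussian P X) {H C₁ C₂ : ℝ} (hH : 0 < H)
    (hC₁ : 0 < C₁) (hC₂ : 0 < C₂)
    (hinc : ∀ t s : unitInterval,
      C₁ * |(t : ℝ) - (s : ℝ)| ^ H ≤ l2Norm P (fun ω => X t ω - X s ω) ∧
      l2Norm P (fun ω => X t ω - X s ω) ≤ C₂ * |(t : ℝ) - (s : ℝ)| ^ H)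
    {B a : ℝ} (hB : 0 < B) (ha : a = (C₁ * Real.exp (-1)) ^ 2) {n : ℕ} (hn : 2 ≤ n)
    (hΔ : discretizationError P X n ≤ B) :
    1 / H ≤ Real.log 2 + (68 / a + 289 * C₂ ^ 2 / (2 * a ^ 2)) *
      (2 * B ^ 2 + 4 * (1 + C₂ ^ 2 / 2) ^ 2 * Real.log n) := by
  have hbd := l2Norm_sub_le_of_forall_le_rpow hH hC₂.le fun t s => (hinc t s).2
  have hn' : (2 : ℝ) ≤ n := by exact_mod_cast hn
  have ha0 : 0 < a := by rw [ha]; positivity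
  set L : ℝ := Real.log (n + 1) with hL
  have hL0 : 0 < L := Real.log_pos (by linarith)
  -- Here `2 ≤ n` enters, through `n + 1 ≤ n ^ 2`.
  have hLn : L ≤ 2 * Real.log n := by
    rw [hL, ← Nat.cast_two, ← Real.log_pow]
    exact Real.log_le_log (by linarith) (by nlinarith)
  have hgrid := hX.integral_iSup_sub_le (gridPoint n) (fun _ => 0) (fun _ => hbd _ _)
    (Real.sqrt_pos.2 hL0)
  rw [discretizationError_eq_integral_sub_zero hX
    (hX.integrable_iSup hH hC₂ fun t s => (hinc t s).2) hgrid.1] at hΔ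
  have hg := hgrid.2
  rw [Fintype.card_fin, Nat.cast_add, Nat.cast_one, ← hL, Real.div_sqrt] at hg
  have hM := hX.one_div_le_of_integral_iSup_le hH hC₁ hC₂ hinc
    (M := B + (1 + C₂ ^ 2 / 2) * √L) (by positivity) (by linarith) ha
  refine hM.trans ?_
  gcongr
  -- This is `(x + y) ^ 2 ≤ 2 * x ^ 2 + 2 * y ^ 2`.
  have h1 := sq_nonneg (B - (1 + C₂ ^ 2 / 2) * √L)
  have h2 := Real.sq_sqrt hL0.le
  have h3 := mul_le_mul_of_nonneg_left hLn (sq_nonneg (1 + C₂ ^ 2 / 2))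
  have h4 : ((1 + C₂ ^ 2 / 2) * √L) ^ 2 = (1 + C₂ ^ 2 / 2) ^ 2 * L := by rw [mul_pow, h2]
  nlinarith

end

theorem theorem3
    {Ω : ℝ → Type*} [∀ H, MeasurableSpace (Ω H)] (P : ∀ H, Measure (Ω H))
    (X : ∀ H, unitInterval → Ω H → ℝ)
    (hX : ∀ H ∈ Set.Ioo (0 : ℝ) 1, IsCenteredContinuousGaussian (P H) (X H))
    (C₁ C₂ : ℝ) (hC₁ : 0 < C₁) (hC₂ : 0 < C₂)
    (hinc : ∀ H ∈ Set.Ioo (0 : ℝ) 1, ∀ t s : unitInterval,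
      C₁ * |(t : ℝ) - (s : ℝ)| ^ H ≤ l2Norm (P H) (fun ω => X H t ω - X H s ω) ∧
      l2Norm (P H) (fun ω => X H t ω - X H s ω) ≤ C₂ * |(t : ℝ) - (s : ℝ)| ^ H)
    (n : ℝ → ℕ) (hn : ∀ H ∈ Set.Ioo (0 : ℝ) 1, 2 ≤ n H)
    (hΔ : limsup (fun H : ℝ => ((discretizationError (P H) (X H) (n H) : ℝ) : EReal))
      (𝓝[>] (0 : ℝ)) < ⊤) :
    (1 : EReal) < liminf (fun H : ℝ => (((n H : ℝ) ^ H : ℝ) : EReal)) (𝓝[>] (0 : ℝ)) := by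
  obtain ⟨B₀, hB₀, -⟩ := EReal.lt_iff_exists_real_btwn.1 hΔ
  have hev := eventually_lt_of_limsup_lt hB₀
  set B : ℝ := max B₀ 1
  have hB : 0 < B := lt_max_of_lt_right one_pos
  set a : ℝ := (C₁ * Real.exp (-1)) ^ 2 with ha
  have ha0 : 0 < a := by positivity
  set K : ℝ := 68 / a + 289 * C₂ ^ 2 / (2 * a ^ 2) with hK
  have hK0 : 0 < K := by positivity
  set A : ℝ := Real.log 2 + K * (2 * B ^ 2) with hA
  have hA0 : 0 < A := by have := Real.log_pos one_lt_two; positivity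
  set D : ℝ := K * (4 * (1 + C₂ ^ 2 / 2) ^ 2) with hD
  have hD0 : 0 < D := by positivity
  -- For `H < 1 / (2 * A)` the term `A * H` is below 1/2, so `1 ≤ A * H + D * H * log n` leaves `H *
  -- log n ≥ 1 / (2 * D)`.
  have hIoo : ∀ᶠ H : ℝ in 𝓝[>] 0, H ∈ Set.Ioo (0 : ℝ) (min 1 (1 / (2 * A))) :=
    Ioo_mem_nhdsGT (by positivity)
  have hlow : ∀ᶠ H : ℝ in 𝓝[>] 0,
      ((Real.exp (1 / (2 * D)) : ℝ) : EReal) ≤ (((n H : ℝ) ^ H : ℝ) : EReal) := by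
    filter_upwards [hev, hIoo] with H hH hHI
    have hH01 : H ∈ Set.Ioo (0 : ℝ) 1 := ⟨hHI.1, hHI.2.trans_le (min_le_left _ _)⟩
    have hHA : H < 1 / (2 * A) := hHI.2.trans_le (min_le_right _ _)
    have hH0 := hH01.1
    have hn2 : (2 : ℝ) ≤ n H := by exact_mod_cast hn H hH01
    have h := (hX H hH01).one_div_le_of_discretizationError_le hH0 hC₁ hC₂ (hinc H hH01) hB ha
      (hn H hH01) ((EReal.coe_lt_coe_iff.1 hH).le.trans (le_max_left _ _))
    have h1 : 1 / H ≤ A + D * Real.log (n H) := by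
      rw [hA, hD]
      linarith
    rw [div_le_iff₀ hH0] at h1
    rw [lt_div_iff₀ (by positivity)] at hHA
    rw [EReal.coe_le_coe_iff, Real.rpow_def_of_pos (by linarith)]
    gcongr
    rw [div_le_iff₀ (by positivity)]
    linarith
  refine lt_of_lt_of_le ?_ (le_liminf_of_le (by isBoundedDefault) hlow)
  exact_mod_cast Real.one_lt_exp_iff.2 (by positivity)
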